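/- Let $\mathbb F$ be a division ring with center $Z_{\mathbb F}$, and let $\mathbb F[z]$ be the ring of polynomials in a variable $z$ commuting with the coefficients. For $f=\sum_j z^jf_j\in\mathbb F[z]$ and $\alpha\in\mathbb F$, the left and right values of $f$ at $\alpha$ are $f^{\mathfrak e_\ell}(\alpha)=\sum_j\alpha^jf_j$ and $f^{\mathfrak e_r}(\alpha)=\sum_jf_j\alpha^j$. A set $\Delta\subset\mathbb F$ is called left (right) algebraic if some nonzero $f\in\mathbb F[z]$ has left (right) value $0$ at every point of $\Delta$. In that case its left (right) minimal polynomial $P_{\Delta,\ell}$ ($P_{\Delta,r}$) is the monic generator of the right ideal $\bigcap_{\alpha\in\Delta}(z-\alpha)\mathbb F[z]$ (of the left ideal $\bigcap_{\alpha\in\Delta}\mathbb F[z](z-\alpha)$), and $\Delta$ is called left (right) $P$-independent if $\deg P_{\Delta,\ell}=|\Delta|$ (if $\deg P_{\Delta,r}=|\Delta|$). For $\Delta_\ell\subset\mathbb F$ left algebraic and $\Delta_r\subset\mathbb F$ right algebraic, the pair $(\Delta_\ell,\Delta_r)$ is called $P$-independent if there is no nonzero $g\in\mathbb F[z]$ with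 $\deg g<|\Delta_\ell|+|\Delta_r|$, $g^{\mathfrak e_\ell}(\alpha)=0$ for all $\alpha\in\Delta_\ell$ and $g^{\mathfrak e_r}(\beta)=0$ for all $\beta\in\Delta_r$. Finally, $[\Delta]=\{h\alpha h^{-1}:\alpha\in\Delta,\ 0\ne h\in\mathbb F\}$. **Proposition 3.8.** Let $\Delta_\ell\subset\mathbb F$ be left algebraic and $\Delta_r\subset\mathbb F$ right algebraic, and assume that every element of $\Delta_\ell$ is algebraic over $Z_{\mathbb F}$. Then the pair $(\Delta_\ell,\Delta_r)$ is $P$-independent if and only if $\Delta_\ell$ is left $P$-independent, $\Delta_r$ is right $P$-independent, and $[\Delta_\ell]\cap[\Delta_r]=\varnothing$. -/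

import Mathlib

namespace TwoSidedPoly

open Polynomial

variable {F : Type*} [DivisionRing F]

/-- The left value `∑ α ^ j * f_j` of `f = ∑ z ^ j f_j` at `α`; the variable commutes with the
coefficients. The right value `∑ f_j * β ^ j` is Mathlib's `Polynomial.eval β f`. -/
def leftEval (α : F) (f : F[X]) : F :=
  f.sum fun j c => α ^ j * c

/-- `Δ` is algebraic with respect to left evaluation: some nonzero polynomial has left value zero
at all points of `Δ`. -/
def IsLeftAlgebraicSet (Δ : Set F) : Prop :=
  ∃ f : F[X], f ≠ 0 ∧ ∀ α ∈ Δ, leftEval α f = 0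

/-- `Δ` is algebraic with respect to right evaluation. -/
def IsRightAlgebraicSet (Δ : Set F) : Prop :=
  ∃ f : F[X], f ≠ 0 ∧ ∀ β ∈ Δ, f.eval β = 0

/-- `P` is the left minimal polynomial of `Δ`, that is, the least right common multiple of the
polynomials `z - α`, `α ∈ Δ`: the monic generator of the right ideal `⋂ (z - α) F[z]`. -/
def IsLeftMinPoly (Δ : Set F) (P : F[X]) : Prop :=
  P.Monic ∧ ∀ f : F[X], (∃ h : F[X], f = P * h) ↔ ∀ α ∈ Δ, ∃ h : F[X], f = (X - C α) * h

/-- `P` is the right minimal polynomial of `Δ`, that is, the least left common multiple of the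
polynomials `z - β`, `β ∈ Δ`: the monic generator of the left ideal `⋂ F[z] (z - β)`. -/
def IsRightMinPoly (Δ : Set F) (P : F[X]) : Prop :=
  P.Monic ∧ ∀ f : F[X], (∃ h : F[X], f = h * P) ↔ ∀ β ∈ Δ, ∃ h : F[X], f = h * (X - C β)

/-- The degree of the left minimal polynomial of `Δ` is the cardinality of `Δ` (so an infinite set
is never left `P`-independent). -/
def LeftPIndependent (Δ : Set F) : Prop :=
  ∃ P : F[X], IsLeftMinPoly Δ P ∧ (P.natDegree : ℕ∞) = Δ.encard

/-- The degree of the right minimal polynomial of `Δ` is the cardinality of `Δ`. -/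
def RightPIndependent (Δ : Set F) : Prop :=
  ∃ P : F[X], IsRightMinPoly Δ P ∧ (P.natDegree : ℕ∞) = Δ.encard

/-- There is no nonzero polynomial `g` of degree less than `|Δl| + |Δr|` whose left values on `Δl`
and right values on `Δr` all vanish. This is the notion for two algebraic sets. -/
def PairPIndependent (Δl Δr : Set F) : Prop :=
  ¬ ∃ g : F[X], g ≠ 0 ∧ (g.natDegree : ℕ∞) < Δl.encard + Δr.encard ∧
    (∀ α ∈ Δl, leftEval α g = 0) ∧ ∀ β ∈ Δr, g.eval β = 0

/-- `[Δ]`, the union of the conjugacy classes `{h α h⁻¹ : h ≠ 0}` of the elements `α` of `Δ`. -/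
def conjClosure (Δ : Set F) : Set F :=
  {x | ∃ α ∈ Δ, ∃ h : F, h ≠ 0 ∧ x = h * α * h⁻¹}

end TwoSidedPoly

namespace TwoSidedPoly

open Polynomial

/-! ### One-sided evaluation: product formulas and division by linear factors. -/

section Evaluation

variable {F : Type*} [DivisionRing F]

/-! Right multiples keep left zeros and left multiples keep right zeros, so `P * Q` vanishes on both
sets when `P` does on the left and `Q` on the right. A `P`-independent pair therefore consists of
finite sets, and both minimal polynomials have full degree. If `α` and `β` were conjugate, a
constant and one linear factor inserted between the minimal polynomials of `Δl \ {α}` and `Δr \ {β}`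
would kill both points, with total degree one too small.

Conversely, let `g = P * u` with `P` the left minimal polynomial. For degree reasons `u` has nonzero
right value at some `β ∈ Δr`. As `P` is a product of factors `X - C a` with `a` conjugate to points
of `Δl`, and such a factor can kill a value only at a conjugate of `a`
(`eval_prod_X_sub_C_mul_ne_zero`), `g` is nonzero at `β` too. -/

theorem leftEval_add (α : F) (f g : F[X]) :
    leftEval α (f + g) = leftEval α f + leftEval α g :=
  Polynomial.sum_add_index f g _ (fun _ => mul_zero _) fun _ _ _ => mul_add _ _ _

theorem leftEval_monomial (α : F) (n : ℕ) (b : F) :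
    leftEval α (monomial n b) = α ^ n * b :=
  Polynomial.sum_monomial_index b _ (mul_zero _)

theorem leftEval_X_sub_C (α a : F) : leftEval α (X - C a : F[X]) = α - a := by
  have h : (X - C a : F[X]) = monomial 1 1 + monomial 0 (-a) := by
    rw [monomial_one_one_eq_X, monomial_zero_left, C_neg, sub_eq_add_neg]
  rw [h, leftEval_add, leftEval_monomial, leftEval_monomial, pow_one, pow_zero, mul_one, one_mul,
    ← sub_eq_add_neg]

theorem leftEval_mul_monomial (α : F) (f : F[X]) (n : ℕ) (b : F) :
    leftEval α (f * monomial n b) = α ^ n * leftEval α f * b := by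
  induction f using Polynomial.induction_on' with
  | add p q hp hq => rw [add_mul, leftEval_add, leftEval_add, hp, hq, mul_add, add_mul]
  | monomial k a =>
    rw [monomial_mul_monomial, leftEval_monomial, leftEval_monomial, add_comm, pow_add]
    simp only [mul_assoc]

theorem leftEval_mul_of_eq_zero {α : F} {f : F[X]} (hf : leftEval α f = 0) (g : F[X]) :
    leftEval α (f * g) = 0 := by
  induction g using Polynomial.induction_on' with
  | add p q hp hq => rw [mul_add, leftEval_add, hp, hq, add_zero]
  | monomial k a => rw [leftEval_mul_monomial, hf, mul_zero, zero_mul]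

/-- The product formula for left values. -/
theorem leftEval_mul {α : F} {f : F[X]} (hf : leftEval α f ≠ 0) (g : F[X]) :
    leftEval α (f * g) =
      leftEval α f * leftEval ((leftEval α f)⁻¹ * α * leftEval α f) g := by
  induction g using Polynomial.induction_on' with
  | add p q hp hq => rw [mul_add, leftEval_add, leftEval_add, hp, hq, mul_add]
  | monomial k a =>
    rw [leftEval_mul_monomial, leftEval_monomial, GroupWithZero.conj_pow₀ hf,
      ← mul_assoc, ← mul_assoc, ← mul_assoc, mul_inv_cancel₀ hf, one_mul]

theorem eval_monomial_mul (β : F) (f : F[X]) (n : ℕ) (b : F) :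
    (monomial n b * f).eval β = b * f.eval β * β ^ n := by
  rw [← C_mul_X_pow_eq_monomial, mul_assoc, X_pow_mul, eval_C_mul, eval_mul_X_pow, mul_assoc]

theorem eval_mul_of_eval_eq_zero {β : F} {f : F[X]} (hf : f.eval β = 0) (g : F[X]) :
    (g * f).eval β = 0 := by
  induction g using Polynomial.induction_on' with
  | add p q hp hq => rw [add_mul, eval_add, hp, hq, add_zero]
  | monomial k a => rw [eval_monomial_mul, hf, mul_zero, zero_mul]

/-- The product formula for right values. -/
theorem eval_mul_of_eval_ne_zero {β : F} {f : F[X]} (hf : f.eval β ≠ 0) (g : F[X]) :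
    (g * f).eval β = g.eval (f.eval β * β * (f.eval β)⁻¹) * f.eval β := by
  induction g using Polynomial.induction_on' with
  | add p q hp hq => rw [add_mul, eval_add, eval_add, hp, hq, add_mul]
  | monomial k a =>
    -- The double inverse puts the conjugate in the shape `a⁻¹ * x * a` of
    -- `GroupWithZero.conj_pow₀`.
    rw [eval_monomial_mul, eval_monomial, ← inv_inv (f.eval β), inv_inv (f.eval β)⁻¹,
      GroupWithZero.conj_pow₀ (inv_ne_zero hf), inv_inv]
    simp only [mul_assoc, inv_mul_cancel₀ hf, mul_one]

/-- With `w = f.eval β`, the value vanishes exactly when `w * β = a * w`; for `w ≠ 0` this makes `a`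
and `β` conjugate. -/
theorem eval_X_sub_C_mul (β a : F) (f : F[X]) :
    ((X - C a) * f).eval β = f.eval β * β - a * f.eval β := by
  rw [sub_mul, X_mul, eval_sub, eval_mul_X, eval_C_mul]

theorem exists_eq_X_sub_C_mul_add (α : F) (f : F[X]) :
    ∃ h : F[X], f = (X - C α) * h + C (leftEval α f) := by
  induction f using Polynomial.induction_on' with
  | add p q hp hq =>
    obtain ⟨u, hu⟩ := hp
    obtain ⟨v, hv⟩ := hq
    refine ⟨u + v, ?_⟩
    rw [leftEval_add, C_add, mul_add]
    nth_rewrite 1 [hu, hv]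
    abel
  | monomial n b =>
    obtain ⟨q, hq⟩ := (commute_X (C α)).sub_dvd_pow_sub_pow n
    refine ⟨q * C b, ?_⟩
    rw [leftEval_monomial, C_mul, C_pow, ← mul_assoc, ← hq, sub_mul, sub_add_cancel, X_pow_mul_C,
      C_mul_X_pow_eq_monomial]

theorem exists_eq_mul_X_sub_C_add (β : F) (f : F[X]) :
    ∃ h : F[X], f = h * (X - C β) + C (f.eval β) := by
  induction f using Polynomial.induction_on' with
  | add p q hp hq =>
    obtain ⟨u, hu⟩ := hp
    obtain ⟨v, hv⟩ := hq
    refine ⟨u + v, ?_⟩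
    rw [eval_add, C_add, add_mul]
    nth_rewrite 1 [hu, hv]
    abel
  | monomial n b =>
    refine ⟨C b * ∑ i ∈ Finset.range n, X ^ i * C β ^ (n - 1 - i), ?_⟩
    rw [eval_monomial, C_mul, C_pow, mul_assoc, (commute_X (C β)).geom_sum₂_mul, mul_sub,
      sub_add_cancel, C_mul_X_pow_eq_monomial]

theorem exists_eq_X_sub_C_mul_iff {α : F} {f : F[X]} :
    (∃ h : F[X], f = (X - C α) * h) ↔ leftEval α f = 0 := by
  constructor
  · rintro ⟨h, rfl⟩
    exact leftEval_mul_of_eq_zero (by rw [leftEval_X_sub_C, sub_self]) h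
  · intro hf
    obtain ⟨h, hh⟩ := exists_eq_X_sub_C_mul_add α f
    exact ⟨h, by rwa [hf, C_0, add_zero] at hh⟩

theorem exists_eq_mul_X_sub_C_iff {β : F} {f : F[X]} :
    (∃ h : F[X], f = h * (X - C β)) ↔ f.eval β = 0 := by
  constructor
  · rintro ⟨h, rfl⟩
    exact eval_mul_of_eval_eq_zero (by simp) h
  · intro hf
    obtain ⟨h, hh⟩ := exists_eq_mul_X_sub_C_add β f
    exact ⟨h, by rwa [hf, C_0, add_zero] at hh⟩

end Evaluation

/-! ### Minimal polynomials of finite sets. -/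

section MinimalPolynomials

variable {F : Type*} [DivisionRing F]

theorem isLeftMinPoly_iff {Δ : Set F} {P : F[X]} :
    IsLeftMinPoly Δ P ↔
      P.Monic ∧ ∀ f : F[X], (∃ h : F[X], f = P * h) ↔ ∀ α ∈ Δ, leftEval α f = 0 := by
  simp only [IsLeftMinPoly, exists_eq_X_sub_C_mul_iff]

theorem isRightMinPoly_iff {Δ : Set F} {P : F[X]} :
    IsRightMinPoly Δ P ↔
      P.Monic ∧ ∀ f : F[X], (∃ h : F[X], f = h * P) ↔ ∀ β ∈ Δ, f.eval β = 0 := by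
  simp only [IsRightMinPoly, exists_eq_mul_X_sub_C_iff]

theorem IsLeftMinPoly.leftEval_eq_zero {Δ : Set F} {P : F[X]} (hP : IsLeftMinPoly Δ P) {α : F}
    (hα : α ∈ Δ) : leftEval α P = 0 :=
  ((isLeftMinPoly_iff.1 hP).2 P).1 ⟨1, (mul_one P).symm⟩ α hα

theorem IsRightMinPoly.eval_eq_zero {Δ : Set F} {P : F[X]} (hP : IsRightMinPoly Δ P) {β : F}
    (hβ : β ∈ Δ) : P.eval β = 0 :=
  ((isRightMinPoly_iff.1 hP).2 P).1 ⟨1, (one_mul P).symm⟩ β hβ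

/-- Each divides the other, so they differ by a unit, which is the constant 1 by monicity. This
transfers the linear factorization to any given minimal polynomial. -/
theorem IsLeftMinPoly.eq {Δ : Set F} {P Q : F[X]} (hP : IsLeftMinPoly Δ P)
    (hQ : IsLeftMinPoly Δ Q) : P = Q := by
  obtain ⟨u, hu⟩ := ((isLeftMinPoly_iff.1 hP).2 Q).2 fun _ => hQ.leftEval_eq_zero
  obtain ⟨v, hv⟩ := ((isLeftMinPoly_iff.1 hQ).2 P).2 fun _ => hP.leftEval_eq_zero
  have huv : u * v = 1 := by
    apply mul_left_cancel₀ hP.1.ne_zero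
    rw [← mul_assoc, ← hu, ← hv, mul_one]
  have hu0 : u.natDegree = 0 := by
    have h := congrArg natDegree huv
    rw [natDegree_mul (left_ne_zero_of_mul_eq_one huv) (right_ne_zero_of_mul_eq_one huv),
      natDegree_one] at h
    omega
  have hlead : u.leadingCoeff = 1 := by
    have h := congrArg leadingCoeff hu
    rwa [leadingCoeff_mul, hP.1.leadingCoeff, hQ.1.leadingCoeff, one_mul, eq_comm] at h
  rw [hu, eq_C_of_natDegree_eq_zero hu0, ← hu0, coeff_natDegree, hlead, C_1, mul_one]

theorem conjClosure_mono {Δ Δ' : Set F} (h : Δ ⊆ Δ') : conjClosure Δ ⊆ conjClosure Δ' := by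
  rintro x ⟨α, hα, k, hk⟩
  exact ⟨α, h hα, k, hk⟩

theorem subset_conjClosure (Δ : Set F) : Δ ⊆ conjClosure Δ :=
  fun α hα => ⟨α, hα, 1, one_ne_zero, by simp⟩

theorem conj_mem_conjClosure {Δ : Set F} {x c : F} (hx : x ∈ conjClosure Δ) (hc : c ≠ 0) :
    c⁻¹ * x * c ∈ conjClosure Δ := by
  obtain ⟨α, hα, h, hh, rfl⟩ := hx
  refine ⟨α, hα, c⁻¹ * h, mul_ne_zero (inv_ne_zero hc) hh, ?_⟩
  simp only [mul_inv_rev, inv_inv, mul_assoc]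

theorem monic_prod_X_sub_C (L : List F) : (L.map fun a => X - C a).prod.Monic := by
  induction L with
  | nil => exact monic_one
  | cons a L ih => rw [List.map_cons, List.prod_cons]; exact (monic_X_sub_C a).mul ih

theorem natDegree_prod_X_sub_C (L : List F) :
    (L.map fun a => X - C a).prod.natDegree = L.length := by
  induction L with
  | nil => simp
  | cons a L ih =>
    rw [List.map_cons, List.prod_cons, (monic_X_sub_C a).natDegree_mul (monic_prod_X_sub_C L), ih,
      natDegree_X_sub_C, List.length_cons, add_comm]

/-- The left minimal polynomial of a finite set is a product of linear factors at conjugates of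
its points. -/
theorem exists_isLeftMinPoly_prod (s : Finset F) :
    ∃ L : List F, (∀ a ∈ L, a ∈ conjClosure (s : Set F)) ∧ L.length ≤ s.card ∧
      IsLeftMinPoly (s : Set F) (L.map fun a => X - C a).prod := by
  classical
  simp only [isLeftMinPoly_iff, monic_prod_X_sub_C, true_and]
  induction s using Finset.induction_on with
  | empty => exact ⟨[], by simp, by simp, fun f => by simp⟩
  | insert α s hα ih =>
    obtain ⟨L, hL, hlen, hP⟩ := ih
    have hsub : conjClosure (s : Set F) ⊆ conjClosure (insert α s : Finset F) :=
      conjClosure_mono (by simp)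
    have hcard := Finset.card_insert_of_notMem hα
    by_cases hc : leftEval α (L.map fun a => X - C a).prod = 0
    · refine ⟨L, fun a ha => hsub (hL a ha), by omega, fun f => ?_⟩
      simp only [Finset.coe_insert, Set.forall_mem_insert, ← hP f, iff_and_self]
      rintro ⟨h, rfl⟩
      exact leftEval_mul_of_eq_zero hc h
    -- By the product formula, a right multiple of the old polynomial vanishes at `α` iff its
    -- cofactor vanishes at this conjugate of `α`.
    · refine ⟨L ++ [(leftEval α (L.map fun a => X - C a).prod)⁻¹ * α *
        leftEval α (L.map fun a => X - C a).prod], ?_, ?_, fun f => ?_⟩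
      · intro a ha
        rcases List.mem_append.1 ha with ha | ha
        · exact hsub (hL a ha)
        · rw [List.mem_singleton.1 ha]
          exact conj_mem_conjClosure (subset_conjClosure _ (by simp)) hc
      · rw [List.length_append, List.length_singleton]
        omega
      · simp only [Finset.coe_insert, Set.forall_mem_insert, ← hP f, List.map_append,
          List.prod_append, List.map_singleton, List.prod_singleton]
        constructor
        · rintro ⟨h, rfl⟩
          refine ⟨?_, (X - C _) * h, mul_assoc _ _ _⟩
          rw [mul_assoc, leftEval_mul hc, exists_eq_X_sub_C_mul_iff.1 ⟨h, rfl⟩, mul_zero]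
        · rintro ⟨h0, h, rfl⟩
          rw [leftEval_mul hc, mul_eq_zero, or_iff_right hc] at h0
          obtain ⟨k, hk⟩ := exists_eq_X_sub_C_mul_iff.2 h0
          exact ⟨k, by rw [mul_assoc, ← hk]⟩

theorem exists_isRightMinPoly (s : Finset F) :
    ∃ P : F[X], P.natDegree ≤ s.card ∧ IsRightMinPoly (s : Set F) P := by
  classical
  simp only [isRightMinPoly_iff]
  induction s using Finset.induction_on with
  | empty => exact ⟨1, by simp, monic_one, fun f => by simp⟩
  | insert β s hβ ih =>
    obtain ⟨P, hdeg, hmonic, hP⟩ := ih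
    have hcard := Finset.card_insert_of_notMem hβ
    by_cases hc : P.eval β = 0
    · refine ⟨P, by omega, hmonic, fun f => ?_⟩
      simp only [Finset.coe_insert, Set.forall_mem_insert, ← hP f, iff_and_self]
      rintro ⟨h, rfl⟩
      exact eval_mul_of_eval_eq_zero hc h
    · refine ⟨(X - C (P.eval β * β * (P.eval β)⁻¹)) * P, ?_, (monic_X_sub_C _).mul hmonic,
        fun f => ?_⟩
      · rw [(monic_X_sub_C _).natDegree_mul hmonic, natDegree_X_sub_C]
        omega
      · simp only [Finset.coe_insert, Set.forall_mem_insert, ← hP f]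
        constructor
        · rintro ⟨h, rfl⟩
          refine ⟨?_, h * (X - C _), (mul_assoc _ _ _).symm⟩
          rw [← mul_assoc, eval_mul_of_eval_ne_zero hc, exists_eq_mul_X_sub_C_iff.1 ⟨h, rfl⟩,
            zero_mul]
        · rintro ⟨h0, h, rfl⟩
          rw [eval_mul_of_eval_ne_zero hc, mul_eq_zero, or_iff_left hc] at h0
          obtain ⟨k, hk⟩ := exists_eq_mul_X_sub_C_iff.2 h0
          exact ⟨k, by rw [← mul_assoc, ← hk]⟩

end MinimalPolynomials

/-! ### Independence of pairs. -/

section Pairs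

variable {F : Type*} [DivisionRing F]

/-- Left multiplication by linear factors at points not conjugate to `β` preserves non-vanishing of
the right value at `β`. -/
theorem eval_prod_X_sub_C_mul_ne_zero {β : F} {L : List F}
    (hL : ∀ a ∈ L, ∀ c : F, c ≠ 0 → β ≠ c⁻¹ * a * c) {u : F[X]} (hu : u.eval β ≠ 0) :
    ((L.map fun a => X - C a).prod * u).eval β ≠ 0 := by
  induction L with
  | nil => simpa using hu
  | cons a L ih =>
    have hw := ih fun b hb => hL b (List.mem_cons_of_mem a hb)
    rw [List.map_cons, List.prod_cons, mul_assoc, eval_X_sub_C_mul]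
    intro h
    apply hL a List.mem_cons_self _ hw
    rw [mul_assoc, ← sub_eq_zero.1 h, ← mul_assoc, inv_mul_cancel₀ hw, one_mul]

theorem PairPIndependent.encard_add_encard_le {Δl Δr : Set F} (h : PairPIndependent Δl Δr)
    {P Q : F[X]} (hP0 : P ≠ 0) (hQ0 : Q ≠ 0) (hP : ∀ α ∈ Δl, leftEval α P = 0)
    (hQ : ∀ β ∈ Δr, Q.eval β = 0) :
    Δl.encard + Δr.encard ≤ ((P.natDegree + Q.natDegree : ℕ) : ℕ∞) := by
  rw [← natDegree_mul hP0 hQ0]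
  by_contra! hlt
  exact h ⟨P * Q, mul_ne_zero hP0 hQ0, hlt, fun α hα => leftEval_mul_of_eq_zero (hP α hα) Q,
    fun β hβ => eval_mul_of_eval_eq_zero (hQ β hβ) P⟩

theorem PairPIndependent.finite {Δl Δr : Set F} (h : PairPIndependent Δl Δr)
    (hl : IsLeftAlgebraicSet Δl) (hr : IsRightAlgebraicSet Δr) : Δl.Finite ∧ Δr.Finite := by
  obtain ⟨P, hP0, hP⟩ := hl
  obtain ⟨Q, hQ0, hQ⟩ := hr
  have hlt := (h.encard_add_encard_le hP0 hQ0 hP hQ).trans_lt (ENat.natCast_lt_top _)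
  rw [← Set.encard_lt_top_iff, ← Set.encard_lt_top_iff]
  exact ⟨le_self_add.trans_lt hlt, le_add_self.trans_lt hlt⟩

/-- Conjugate points `α`, `β` can share a single linear factor, which saves one degree. -/
theorem PairPIndependent.disjoint_conjClosure {s t : Finset F}
    (h : PairPIndependent (s : Set F) (t : Set F)) :
    conjClosure (s : Set F) ∩ conjClosure (t : Set F) = ∅ := by
  classical
  rw [Set.eq_empty_iff_forall_notMem]
  rintro x ⟨⟨α, hα, a, ha, rfl⟩, β, hβ, b, hb, hab⟩
  rw [Finset.mem_coe] at hα hβ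
  obtain ⟨L, -, hlen, hP⟩ := exists_isLeftMinPoly_prod (s.erase α)
  obtain ⟨Q, hQdeg, hQ⟩ := exists_isRightMinPoly (t.erase β)
  have hPdeg := (natDegree_prod_X_sub_C L).le.trans hlen
  generalize (L.map fun a => X - C a).prod = P at hP hPdeg
  have hs := Finset.card_erase_add_one hα
  have ht := Finset.card_erase_add_one hβ
  have key : ∀ u v : F[X], u ≠ 0 → v ≠ 0 → (∀ γ ∈ s, leftEval γ u = 0) →
      (∀ γ ∈ t, v.eval γ = 0) → s.card + t.card ≤ u.natDegree + v.natDegree := by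
    intro u v hu hv hul hvr
    have := h.encard_add_encard_le hu hv hul hvr
    rw [Set.encard_coe_eq_coe_finsetCard, Set.encard_coe_eq_coe_finsetCard] at this
    exact_mod_cast this
  obtain ⟨L', -, hlen', hP'⟩ := exists_isLeftMinPoly_prod s
  have hPdeg' := (natDegree_prod_X_sub_C L').le.trans hlen'
  obtain ⟨Q', hQdeg', hQ'⟩ := exists_isRightMinPoly t
  -- Otherwise `P`, of degree below `s.card`, would already annihilate `s`.
  have hc : leftEval α P ≠ 0 := by
    intro hc
    have := key P Q' hP.1.ne_zero hQ'.1.ne_zero (fun γ hγ => ?_) fun γ hγ => hQ'.eval_eq_zero hγ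
    · omega
    · by_cases hγα : γ = α
      · rw [hγα, hc]
      · exact hP.leftEval_eq_zero (by simp [hγα, hγ])
  have hd : Q.eval β ≠ 0 := by
    intro hd
    have := key _ Q hP'.1.ne_zero hQ.1.ne_zero (fun γ hγ => hP'.leftEval_eq_zero hγ) fun γ hγ => ?_
    · omega
    · by_cases hγβ : γ = β
      · rw [hγβ, hd]
      · exact hQ.eval_eq_zero (by simp [hγβ, hγ])
  set c := leftEval α P
  set d := Q.eval β with hd_def
  -- The constant `k` is chosen so that `w = k * d = c⁻¹ * a⁻¹ * b` satisfies `w * β = (c⁻¹ * α * c)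
  -- * w`. Then `X - C (c⁻¹ * α * c)` kills `α` after `P` and `β` before `C k * Q`.
  have hwd : c⁻¹ * a⁻¹ * b * d⁻¹ ≠ 0 :=
    mul_ne_zero (mul_ne_zero (mul_ne_zero (inv_ne_zero hc) (inv_ne_zero ha)) hb) (inv_ne_zero hd)
  have hlin : (X - C (c⁻¹ * α * c)) * (C (c⁻¹ * a⁻¹ * b * d⁻¹) * Q) ≠ 0 :=
    mul_ne_zero (X_sub_C_ne_zero _) (mul_ne_zero (C_ne_zero.2 hwd) hQ.1.ne_zero)
  apply h
  refine ⟨P * ((X - C (c⁻¹ * α * c)) * (C (c⁻¹ * a⁻¹ * b * d⁻¹) * Q)),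
    mul_ne_zero hP.1.ne_zero hlin, ?_, fun γ hγ => ?_, fun γ hγ => ?_⟩
  · rw [Set.encard_coe_eq_coe_finsetCard, Set.encard_coe_eq_coe_finsetCard,
      natDegree_mul hP.1.ne_zero hlin, natDegree_mul (X_sub_C_ne_zero _)
      (mul_ne_zero (C_ne_zero.2 hwd) hQ.1.ne_zero), natDegree_X_sub_C, natDegree_C_mul hwd]
    norm_cast
    omega
  · by_cases hγα : γ = α
    · rw [hγα, leftEval_mul hc, exists_eq_X_sub_C_mul_iff.1 ⟨_, rfl⟩, mul_zero]
    · exact leftEval_mul_of_eq_zero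
        (hP.leftEval_eq_zero (by simpa [hγα] using hγ)) _
  · apply eval_mul_of_eval_eq_zero
    by_cases hγβ : γ = β
    · rw [hγβ, eval_X_sub_C_mul, eval_C_mul, ← hd_def, inv_mul_cancel_right₀ hd, sub_eq_zero]
      have hαβ : a⁻¹ * b * β = α * (a⁻¹ * b) := by
        have := congrArg (fun x => a⁻¹ * x * b) hab
        simp only [mul_assoc, inv_mul_cancel₀ hb, mul_one, inv_mul_cancel_left₀ ha] at this
        simp only [mul_assoc, ← this]
      calc c⁻¹ * a⁻¹ * b * β = c⁻¹ * (a⁻¹ * b * β) := by simp only [mul_assoc]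
        _ = c⁻¹ * α * c * (c⁻¹ * a⁻¹ * b) := by
          rw [hαβ]
          simp only [mul_assoc, mul_inv_cancel_left₀ hc]
    · rw [← mul_assoc]
      exact eval_mul_of_eval_eq_zero
        (hQ.eval_eq_zero (by simpa [hγβ] using hγ)) _

/-- Each degree is at most the cardinality, while independence bounds their sum from below, so both
are equalities. -/
theorem PairPIndependent.leftPIndependent_and_rightPIndependent {s t : Finset F}
    (h : PairPIndependent (s : Set F) (t : Set F)) :
    LeftPIndependent (s : Set F) ∧ RightPIndependent (t : Set F) := by
  obtain ⟨L, -, hlen, hP⟩ := exists_isLeftMinPoly_prod s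
  obtain ⟨Q, hQdeg, hQ⟩ := exists_isRightMinPoly t
  have hPdeg := (natDegree_prod_X_sub_C L).le.trans hlen
  have hle := h.encard_add_encard_le hP.1.ne_zero hQ.1.ne_zero
    (fun _ => hP.leftEval_eq_zero) fun _ => hQ.eval_eq_zero
  rw [Set.encard_coe_eq_coe_finsetCard, Set.encard_coe_eq_coe_finsetCard] at hle
  norm_cast at hle
  refine ⟨⟨_, hP, ?_⟩, ⟨Q, hQ, ?_⟩⟩
  · rw [Set.encard_coe_eq_coe_finsetCard, Nat.cast_inj]
    omega
  · rw [Set.encard_coe_eq_coe_finsetCard, Nat.cast_inj]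
    omega

theorem LeftPIndependent.finite {Δ : Set F} (h : LeftPIndependent Δ) : Δ.Finite := by
  obtain ⟨P, -, hdeg⟩ := h
  rw [← Set.encard_lt_top_iff, ← hdeg]
  exact ENat.natCast_lt_top _

theorem LeftPIndependent.pairPIndependent {Δl Δr : Set F} (hl : LeftPIndependent Δl)
    (hr : RightPIndependent Δr) (hdisj : conjClosure Δl ∩ conjClosure Δr = ∅) :
    PairPIndependent Δl Δr := by
  rintro ⟨g, hg0, hdeg, hgl, hgr⟩
  obtain ⟨s, rfl⟩ := hl.finite.exists_finset_coe
  obtain ⟨P, hP, hPdeg⟩ := hl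
  obtain ⟨Q, hQ, hQdeg⟩ := hr
  obtain ⟨L, hL, -, hPL⟩ := exists_isLeftMinPoly_prod s
  obtain ⟨u, rfl⟩ := ((isLeftMinPoly_iff.1 hP).2 g).2 hgl
  have hu0 : u ≠ 0 := right_ne_zero_of_mul hg0
  rw [← hPdeg, ← hQdeg, natDegree_mul hP.1.ne_zero hu0] at hdeg
  norm_cast at hdeg
  -- Otherwise `u` would be a left multiple of `Q`, although its degree is smaller.
  obtain ⟨β, hβ, huβ⟩ : ∃ β ∈ Δr, u.eval β ≠ 0 := by
    by_contra! hall
    obtain ⟨v, rfl⟩ := ((isRightMinPoly_iff.1 hQ).2 u).2 hall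
    rw [natDegree_mul (left_ne_zero_of_mul hu0) hQ.1.ne_zero] at hdeg
    omega
  refine eval_prod_X_sub_C_mul_ne_zero (L := L) (fun a ha c hc hβa => ?_) huβ
    (hP.eq hPL ▸ hgr β hβ)
  refine (Set.eq_empty_iff_forall_notMem.1 hdisj) β ⟨?_, subset_conjClosure _ hβ⟩
  rw [hβa]
  exact conj_mem_conjClosure (hL a ha) hc

end Pairs

end TwoSidedPoly

theorem proposition3p8 {F : Type*} [DivisionRing F] (Δl Δr : Set F)
    (hl : TwoSidedPoly.IsLeftAlgebraicSet Δl) (hr : TwoSidedPoly.IsRightAlgebraicSet Δr)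
    (hcenter : ∀ α ∈ Δl, IsAlgebraic (Subring.center F) α) :
    TwoSidedPoly.PairPIndependent Δl Δr ↔
      TwoSidedPoly.LeftPIndependent Δl ∧ TwoSidedPoly.RightPIndependent Δr ∧
        TwoSidedPoly.conjClosure Δl ∩ TwoSidedPoly.conjClosure Δr = ∅ := by
  constructor
  · intro h
    obtain ⟨hfl, hfr⟩ := h.finite hl hr
    obtain ⟨s, rfl⟩ := hfl.exists_finset_coe
    obtain ⟨t, rfl⟩ := hfr.exists_finset_coe
    have hlr := h.leftPIndependent_and_rightPIndependent
    exact ⟨hlr.1, hlr.2, h.disjoint_conjClosure⟩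
  · rintro ⟨h₁, h₂, h₃⟩
    exact h₁.pairPIndependent h₂ h₃
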